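/- **Games.** A simple stochastic game consists of a finite set $V$ partitioned into $\mathit{MIN},\mathit{MAX},\mathit{AV},\mathit{SINK}$, successor functions $\eta_{\min}:\mathit{MIN}\to\mathcal P(V)$ and $\eta_{\max}:\mathit{MAX}\to\mathcal P(V)$, a probability distribution $\eta_{\mathrm{av}}(v)$ on $V$ for every $v\in\mathit{AV}$, and weights $w:\mathit{SINK}\to[0,1]$. No stopping condition is assumed. Its value function $\mathcal V:[0,1]^V\to[0,1]^V$ is $$\mathcal V(a)(v)=\begin{cases}\min_{v'\in\eta_{\min}(v)}a(v') & v\in\mathit{MIN}\\ \max_{v'\in\eta_{\max}(v)}a(v') & v\in\mathit{MAX}\\ \sum_{v'\in V}\eta_{\mathrm{av}}(v)(v')\,a(v') & v\in\mathit{AV}\\ w(v) & v\in\mathit{SINK}\end{cases}$$ (with $\min\emptyset=1$, $\max\emptyset=0$ in $[0,1]$). A Min-strategy is a map $\tau:\mathit{MIN}\to V$ with $\tau(v)\in\eta_{\min}(v)$ for all $v$; $\mathcal V_\tau$ is $\mathcal V$ with $\mathcal V_\tau(a)(v)=a(\tau(v))$ for $v\in\mathit{MIN}$. Max-strategies $\sigma$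 and $\mathcal V_\sigma$ are defined analogously. $\mu f$ and $\nu f$ denote the least and greatest fixpoint of a monotone map $f$. **Switching.** $\mathit{sw}_{\min}(\tau,a)$ is any Min-strategy $\tau'$ such that $\tau'(v)\in\arg\min_{v'\in\eta_{\min}(v)}a(v')$ if $\min_{v'\in\eta_{\min}(v)}a(v')<a(\tau(v))$, and $\tau'(v)=\tau(v)$ otherwise (ties are broken arbitrarily). $\mathit{sw}_{\max}(\sigma,a)$ is defined analogously, with $\max$ and $>$. **Dual approximation.** Write $x\ominus y=\max(x-y,0)$; $\theta_{S}$ is the function that is $\theta$ on $S\subseteq V$ and $0$ elsewhere; $[V]^a=\{v\mid a(v)\ne0\}$. For monotone $f:[0,1]^V\to[0,1]^V$, $a\in[0,1]^V$, $\theta\in[0,1]$ and $S\subseteq V$ let $$f^{a,\theta}_\#(S)=\{v\in[V]^{f(a)}\mid f(a)(v)\ominus f(a\ominus\theta_S)(v)\ge\theta\},$$ $$\iota^a_f(S,v)=\max\{\theta\mid v\in f^{a,\theta}_\#(S)\},\qquad \iota^a_f(S)=\min_{v\in S}\iota^a_f(S,v).$$ Let $\delta^a=\min_{v\in[V]^a}a(v)$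 (with $\min\emptyset=1$) and $$\iota^a_f=\min\big(\{\iota^a_f(S,v)\mid S\subseteq[V]^a,\ v\in[V]^{f(a)},\ \iota^a_f(S,v)\neq0\}\cup\{\delta^a\}\big).$$ The dual $a$-approximation of $f$ is $f^a_\#=f^{a,\iota^a_f}_\#$. **Strategy iteration from above.** 1. Guess a Min-strategy $\tau$. 2. $a:=\mu\mathcal V_\tau$. 3. $\tau':=\mathit{sw}_{\min}(\tau,a)$. 4. If $\tau'\ne\tau$, set $\tau:=\tau'$ and go to 2. 5. $V':=\nu\mathcal V^a_\#$. 6. If $V'=\emptyset$, stop and return $a$. Otherwise set $\tau:=\mathit{sw}_{\min}\big(\tau,\,a\ominus(\iota^a_{\mathcal V}(V'))_{V'}\big)$ and go to 2. **Strategy iteration from below.** 1. Guess a Max-strategy $\sigma$. 2. $a:=\mu\mathcal V_\sigma$. 3. $\sigma':=\mathit{sw}_{\max}(\sigma,a)$. 4. If $\sigma'\neq\sigma$, set $\sigma:=\sigma'$ and go to 2; otherwise stop and return $a$. **Theorem.** For every simple stochastic game, every initial Min-strategy and every initial Max-strategy, both algorithms terminate and return $\mu\mathcal V$, the least fixpoint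 of $\mathcal V$: for all choices made when switching, every run is finite, never gets stuck, and stops with result $\mu\mathcal V$. -/

import Mathlib

noncomputable section

/-! ## The MV-chain `[0,1]` and approximations in the dual sense -/

/-- Truncated subtraction `x ⊖ y = max (x - y) 0` on `[0,1]`. -/
def truncSub (x y : unitInterval) : unitInterval :=
  ⟨max ((x : ℝ) - y) 0, le_max_right _ _,
    max_le (by linarith [x.2.2, y.2.1]) zero_le_one⟩

/-- The function `a ⊖ θ_S`: `a` lowered by `θ` on the set `S` and unchanged elsewhere. -/
def lowerOn {V : Type*} (a : V → unitInterval) (θ : unitInterval) (S : Set V) : V → unitInterval :=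
  fun v => truncSub (a v) (S.indicator (fun _ => θ) v)

/-- The set of points where `a` does not vanish, so that a decrease is possible. -/
def posSet {V : Type*} (a : V → unitInterval) : Set V := {v | a v ≠ 0}

theorem truncSub_mono {x x' y y' : unitInterval} (hx : x ≤ x') (hy : y' ≤ y) :
    truncSub x y ≤ truncSub x' y' := by
  have h1 : (x : ℝ) ≤ x' := hx
  have h2 : (y' : ℝ) ≤ y := hy
  have h3 : (x : ℝ) - y ≤ x' - y' := by linarith
  exact Subtype.mk_le_mk.2 (max_le_max h3 le_rfl)

theorem lowerOn_anti {V : Type*} (a : V → unitInterval) (θ : unitInterval) {S T : Set V}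
    (h : S ⊆ T) :
    lowerOn a θ T ≤ lowerOn a θ S :=
  fun v => truncSub_mono le_rfl
    (Set.indicator_le_indicator_of_subset h (fun _ => θ.2.1) v)

/-- The dual `(θ, a)`-approximation of `f`: the set of those points where `f a` is non-zero and to
which `f` propagates a decrease of `a` by `θ` on the set `S`. It is stated for all sets `S`; it
takes its values in the subsets of `posSet (f a)`. -/
def approxAt {V : Type*} (f : (V → unitInterval) →o (V → unitInterval)) (a : V → unitInterval) (θ : unitInterval) : Set V →o Set V where
  toFun S := {v | v ∈ posSet (f a) ∧ θ ≤ truncSub (f a v) (f (lowerOn a θ S) v)}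
  monotone' := fun _ _ h _ hv =>
    ⟨hv.1, hv.2.trans (truncSub_mono le_rfl (f.monotone (lowerOn_anti a θ h) _))⟩

/-- The largest decrease `θ` on `S` that `f` propagates to the point `v`. -/
def maxDecreaseAt {V : Type*} (f : (V → unitInterval) →o (V → unitInterval)) (a : V → unitInterval) (S : Set V) (v : V) : unitInterval :=
  sSup {θ : unitInterval | v ∈ approxAt f a θ S}

/-- The largest decrease on `S` that `f` propagates to all points of `S`. -/
def maxDecreaseOn {V : Type*} (f : (V → unitInterval) →o (V → unitInterval)) (a : V → unitInterval) (S : Set V) : unitInterval :=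
  ⨅ v ∈ S, maxDecreaseAt f a S v

/-- The least non-zero value of `a` (and `1` if `a` vanishes everywhere). -/
def leastPos {V : Type*} (a : V → unitInterval) : unitInterval := ⨅ v ∈ posSet a, a v

/-- The decrease used in the definition of the dual `a`-approximation: the least one among
`leastPos a` and all non-zero `maxDecreaseAt f a S v`, for `S ⊆ posSet a`, `v ∈ posSet (f a)`. -/
def approxDecrease {V : Type*} (f : (V → unitInterval) →o (V → unitInterval)) (a : V → unitInterval) : unitInterval :=
  sInf ({θ : unitInterval | ∃ S : Set V, S ⊆ posSet a ∧ ∃ v ∈ posSet (f a),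
      maxDecreaseAt f a S v = θ ∧ θ ≠ 0} ∪ {leastPos a})

/-- The dual `a`-approximation of `f`. If `a` is a fixpoint of `f`, then all its values are subsets
of `posSet a`, so its greatest fixpoint among all sets of points is the greatest fixpoint of its
restriction to the subsets of `posSet a`. -/
def approx {V : Type*} (f : (V → unitInterval) →o (V → unitInterval)) (a : V → unitInterval) : Set V →o Set V :=
  approxAt f a (approxDecrease f a)

/-! ## Simple stochastic games -/

/-- The kinds of nodes of a simple stochastic game. -/
inductive NodeKind where
  | min
  | max
  | av
  | sink

/-- A simple stochastic game with set of nodes `V`, which `kind` partitions into the nodes of Min,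
the nodes of Max, the average nodes and the sinks. -/
structure SimpleStochasticGame (V : Type*) [Fintype V] where
  kind : V → NodeKind
  succMin : {v : V // kind v = .min} → Finset V
  succMax : {v : V // kind v = .max} → Finset V
  distr : {v : V // kind v = .av} → stdSimplex ℝ V
  weight : {v : V // kind v = .sink} → unitInterval

/-- The average of `a` with respect to the probability distribution `p`. -/
def average {V : Type*} [Fintype V] (p : stdSimplex ℝ V) (a : V → unitInterval) : unitInterval :=
  ⟨∑ v, p.1 v * (a v : ℝ),
    Finset.sum_nonneg fun v _ => mul_nonneg (p.2.1 v) (a v).2.1,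
    (Finset.sum_le_sum fun v _ => mul_le_of_le_one_right (p.2.1 v) (a v).2.2).trans p.2.2.le⟩

theorem average_mono {V : Type*} [Fintype V] (p : stdSimplex ℝ V) {a b : V → unitInterval} (h : a ≤ b) :
    average p a ≤ average p b :=
  Subtype.mk_le_mk.2 <|
    Finset.sum_le_sum fun v _ => mul_le_mul_of_nonneg_left (h v) (p.2.1 v)

namespace SimpleStochasticGame

variable {V : Type*} [Fintype V] (G : SimpleStochasticGame V)

/-- The nodes of Min. -/
abbrev MinNode : Type _ := {v : V // G.kind v = .min}

/-- The nodes of Max. -/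
abbrev MaxNode : Type _ := {v : V // G.kind v = .max}

/-- A Min-strategy selects a successor of every Min node. -/
abbrev MinStrategy : Type _ := (v : G.MinNode) → {w : V // w ∈ G.succMin v}

/-- A Max-strategy selects a successor of every Max node. -/
abbrev MaxStrategy : Type _ := (v : G.MaxNode) → {w : V // w ∈ G.succMax v}

/-- The values after one step, where the values `m` and `M` at the nodes of Min and Max are given,
average nodes average over `a`, and sinks have their weight. -/
def oneStep (m : G.MinNode → unitInterval) (M : G.MaxNode → unitInterval) (a : V → unitInterval) (v : V) : unitInterval :=
  match h : G.kind v with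
  | .min => m ⟨v, h⟩
  | .max => M ⟨v, h⟩
  | .av => average (G.distr ⟨v, h⟩) a
  | .sink => G.weight ⟨v, h⟩

theorem oneStep_mono {m m' : G.MinNode → unitInterval} {M M' : G.MaxNode → unitInterval} {a a' : V → unitInterval}
    (hm : m ≤ m') (hM : M ≤ M') (ha : a ≤ a') : G.oneStep m M a ≤ G.oneStep m' M' a' := by
  intro v
  unfold oneStep
  split
  · exact hm _
  · exact hM _
  · exact average_mono _ ha
  · exact le_rfl

/-- The value function `𝒱` of the game: minimum over the successors of Min nodes, maximum over the
successors of Max nodes (in `[0,1]`, so the minimum and maximum of nothing are `1` and `0`). -/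
def value : (V → unitInterval) →o (V → unitInterval) where
  toFun a := G.oneStep (fun v => (G.succMin v).inf a) (fun v => (G.succMax v).sup a) a
  monotone' := fun _ _ h => G.oneStep_mono
    (fun _ => Finset.inf_mono_fun fun w _ => h w) (fun _ => Finset.sup_mono_fun fun w _ => h w) h

/-- The value function `𝒱_τ` for a fixed Min-strategy `τ`. -/
def valueMin (τ : G.MinStrategy) : (V → unitInterval) →o (V → unitInterval) where
  toFun a := G.oneStep (fun v => a (τ v)) (fun v => (G.succMax v).sup a) a
  monotone' := fun _ _ h => G.oneStep_mono
    (fun _ => h _) (fun _ => Finset.sup_mono_fun fun w _ => h w) h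

/-- The value function `𝒱_σ` for a fixed Max-strategy `σ`. -/
def valueMax (σ : G.MaxStrategy) : (V → unitInterval) →o (V → unitInterval) where
  toFun a := G.oneStep (fun v => (G.succMin v).inf a) (fun v => a (σ v)) a
  monotone' := fun _ _ h => G.oneStep_mono
    (fun _ => Finset.inf_mono_fun fun w _ => h w) (fun _ => h _) h

/-- `τ'` is a possible result of switching the Min-strategy `τ` with respect to `a`: at the switch
nodes, where this is a strict improvement, some successor of minimal value is chosen, and
elsewhere `τ'` agrees with `τ`. -/
def IsSwitchMin (τ : G.MinStrategy) (a : V → unitInterval) (τ' : G.MinStrategy) : Prop :=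
  ∀ v : G.MinNode,
    ((G.succMin v).inf a < a (τ v) → a (τ' v) = (G.succMin v).inf a) ∧
    (¬ (G.succMin v).inf a < a (τ v) → τ' v = τ v)

/-- `σ'` is a possible result of switching the Max-strategy `σ` with respect to `a`. -/
def IsSwitchMax (σ : G.MaxStrategy) (a : V → unitInterval) (σ' : G.MaxStrategy) : Prop :=
  ∀ v : G.MaxNode,
    (a (σ v) < (G.succMax v).sup a → a (σ' v) = (G.succMax v).sup a) ∧
    (¬ a (σ v) < (G.succMax v).sup a → σ' v = σ v)

/-! ## Strategy iteration -/

/-- Configurations of strategy iteration from above: the line that is executed next, with the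
current values of the variables that are still needed. -/
inductive AboveConfig where
  /-- About to compute the least fixpoint for the current strategy `τ`. -/
  | evaluate (τ : G.MinStrategy)
  /-- About to switch `τ` with respect to `a`. -/
  | improve (τ : G.MinStrategy) (a : V → unitInterval)
  /-- About to compare `τ` with the switched strategy `τ'`. -/
  | compare (τ : G.MinStrategy) (a : V → unitInterval) (τ' : G.MinStrategy)
  /-- About to compute the greatest fixpoint of the dual `a`-approximation. -/
  | check (τ : G.MinStrategy) (a : V → unitInterval)
  /-- About to stop if `S` is empty and to lower `a` on `S` otherwise. -/
  | escape (τ : G.MinStrategy) (a : V → unitInterval) (S : Set V)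
  /-- Stopped with result `a`. -/
  | returned (a : V → unitInterval)

/-- The steps of strategy iteration from above. -/
inductive AboveStep : G.AboveConfig → G.AboveConfig → Prop where
  | evaluate (τ : G.MinStrategy) :
      AboveStep (.evaluate τ) (.improve τ (OrderHom.lfp (G.valueMin τ)))
  | improve (τ : G.MinStrategy) (a : V → unitInterval) (τ' : G.MinStrategy) (h : G.IsSwitchMin τ a τ') :
      AboveStep (.improve τ a) (.compare τ a τ')
  | changed (τ : G.MinStrategy) (a : V → unitInterval) (τ' : G.MinStrategy) (h : τ' ≠ τ) :
      AboveStep (.compare τ a τ') (.evaluate τ')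
  | unchanged (τ : G.MinStrategy) (a : V → unitInterval) :
      AboveStep (.compare τ a τ) (.check τ a)
  | check (τ : G.MinStrategy) (a : V → unitInterval) :
      AboveStep (.check τ a) (.escape τ a (OrderHom.gfp (approx G.value a)))
  | finish (τ : G.MinStrategy) (a : V → unitInterval) :
      AboveStep (.escape τ a ∅) (.returned a)
  | escape (τ : G.MinStrategy) (a : V → unitInterval) (S : Set V) (hS : S ≠ ∅) (τ' : G.MinStrategy)
      (h : G.IsSwitchMin τ (lowerOn a (maxDecreaseOn G.value a S) S) τ') :
      AboveStep (.escape τ a S) (.evaluate τ')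

/-- Configurations of strategy iteration from below. -/
inductive BelowConfig where
  /-- About to compute the least fixpoint for the current strategy `σ`. -/
  | evaluate (σ : G.MaxStrategy)
  /-- About to switch `σ` with respect to `a`. -/
  | improve (σ : G.MaxStrategy) (a : V → unitInterval)
  /-- About to compare `σ` with the switched strategy `σ'`. -/
  | compare (σ : G.MaxStrategy) (a : V → unitInterval) (σ' : G.MaxStrategy)
  /-- Stopped with result `a`. -/
  | returned (a : V → unitInterval)

/-- The steps of strategy iteration from below. -/
inductive BelowStep : G.BelowConfig → G.BelowConfig → Prop where
  | evaluate (σ : G.MaxStrategy) :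
      BelowStep (.evaluate σ) (.improve σ (OrderHom.lfp (G.valueMax σ)))
  | improve (σ : G.MaxStrategy) (a : V → unitInterval) (σ' : G.MaxStrategy) (h : G.IsSwitchMax σ a σ') :
      BelowStep (.improve σ a) (.compare σ a σ')
  | changed (σ : G.MaxStrategy) (a : V → unitInterval) (σ' : G.MaxStrategy) (h : σ' ≠ σ) :
      BelowStep (.compare σ a σ') (.evaluate σ')
  | finish (σ : G.MaxStrategy) (a : V → unitInterval) :
      BelowStep (.compare σ a σ) (.returned a)

end SimpleStochasticGame

/-- Total correctness of a non-deterministic procedure: every run from `start` is finite, and every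
run that cannot be continued has ended in `final`. -/
def AlwaysEndsIn {C : Type*} (step : C → C → Prop) (start final : C) : Prop :=
  (¬ ∃ run : ℕ → C, run 0 = start ∧ ∀ n, step (run n) (run (n + 1))) ∧
  ∀ c, Relation.ReflTransGen step start c → (∀ c', ¬ step c c') → c = final

end

open Set

/-! There are finitely many strategies, so it suffices that each change of strategy strictly
improves the least fixpoint and that the final fixpoint is the least one of `value`. Switching with
respect to `a` makes the strategy's value function agree with `value` at `a`, so stability makes `a`
a fixpoint of `value`.

The carrying lemma is `IsNonexpansive.exists_decrease`: if `a` exceeds a pre-fixpoint `m` of a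
nonexpansive `f`, the points of maximal excess can be lowered together, and `f` propagates this
decrease back to them. For `f = value` they form a post-fixpoint of `approx`, so an empty greatest
fixpoint certifies leastness; a non-empty one gives a smaller pre-fixpoint, from which Min improves
(`IsNonexpansive.lowerOn_maxDecreaseOn`). For Max, the same lemma shows that switching cannot lower
the least fixpoint (`IsSwitchMax.lfp_le_lfp`). -/

/-! ## Nonexpansive maps -/

/-- Nonexpansiveness with respect to the supremum metric, for monotone maps. -/
def IsNonexpansive {V : Type*} (f : (V → unitInterval) →o (V → unitInterval)) : Prop :=
  ∀ (a b : V → unitInterval) (c : ℝ), 0 ≤ c → (∀ v, (a v : ℝ) ≤ b v + c) →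
    ∀ v, (f a v : ℝ) ≤ f b v + c

/-! ### Propagation of decreases by monotone and nonexpansive maps. -/

section Approximation

variable {V : Type*} {f : (V → unitInterval) →o (V → unitInterval)} {a m : V → unitInterval}
  {θ θ' : unitInterval} {S : Set V} {v : V}

theorem lowerOn_of_mem (a : V → unitInterval) (θ : unitInterval) (h : v ∈ S) :
    (lowerOn a θ S v : ℝ) = max ((a v : ℝ) - θ) 0 := by
  simp [lowerOn, truncSub, h]

theorem lowerOn_of_notMem (a : V → unitInterval) (θ : unitInterval) (h : v ∉ S) :
    lowerOn a θ S v = a v := by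
  apply Subtype.ext
  simpa [lowerOn, truncSub, h] using (a v).2.1

theorem lowerOn_le (a : V → unitInterval) (θ : unitInterval) (S : Set V) : lowerOn a θ S ≤ a := by
  intro v
  by_cases h : v ∈ S
  · refine Subtype.coe_le_coe.1 ?_
    rw [lowerOn_of_mem a θ h]
    exact max_le (by linarith [θ.2.1]) (a v).2.1
  · rw [lowerOn_of_notMem a θ h]

theorem lowerOn_anti_right (a : V → unitInterval) (S : Set V) (h : θ ≤ θ') :
    lowerOn a θ' S ≤ lowerOn a θ S := by
  intro v
  by_cases hv : v ∈ S
  · refine Subtype.coe_le_coe.1 ?_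
    rw [lowerOn_of_mem a θ hv, lowerOn_of_mem a θ' hv]
    exact max_le_max (sub_le_sub_left (Subtype.coe_le_coe.2 h) _) le_rfl
  · rw [lowerOn_of_notMem a θ hv, lowerOn_of_notMem a θ' hv]

theorem mem_approxAt_iff :
    v ∈ approxAt f a θ S ↔ f a v ≠ 0 ∧ (θ : ℝ) + f (lowerOn a θ S) v ≤ f a v := by
  have h : (f (lowerOn a θ S) v : ℝ) ≤ f a v := f.monotone (lowerOn_le a θ S) v
  change (f a v ≠ 0 ∧ (θ : ℝ) ≤ max ((f a v : ℝ) - f (lowerOn a θ S) v) 0) ↔ _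
  rw [max_eq_left (sub_nonneg.2 h), le_sub_iff_add_le]

theorem le_maxDecreaseAt (h : v ∈ approxAt f a θ S) : θ ≤ maxDecreaseAt f a S v :=
  le_sSup h

/-- The supremum is attained by monotonicity alone: lowering `a` by the supremum drops `f a v` at
least as much as lowering by any admissible `θ`, so this drop bounds them all. -/
theorem mem_approxAt_maxDecreaseAt (h : f a v ≠ 0) :
    v ∈ approxAt f a (maxDecreaseAt f a S v) S := by
  refine ⟨h, sSup_le fun θ hθ => hθ.2.trans (truncSub_mono le_rfl ?_)⟩
  exact f.monotone (lowerOn_anti_right a S (le_maxDecreaseAt hθ)) v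

/-- Decreasing by `θ'` instead of `θ` raises the argument by at most `θ - θ'`, hence also the image.
-/
theorem IsNonexpansive.mem_approxAt_of_le (hf : IsNonexpansive f) (h : v ∈ approxAt f a θ S)
    (hθ : θ' ≤ θ) : v ∈ approxAt f a θ' S := by
  rw [mem_approxAt_iff] at h ⊢
  have hθ' : (θ' : ℝ) ≤ θ := hθ
  have := hf (lowerOn a θ' S) (lowerOn a θ S) (θ - θ') (sub_nonneg.2 hθ') (fun w => by
    by_cases hw : w ∈ S
    · rw [lowerOn_of_mem a _ hw, lowerOn_of_mem a _ hw]
      refine max_le ?_ ?_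
      · linarith [le_max_left ((a w : ℝ) - θ) 0]
      · linarith [le_max_right ((a w : ℝ) - θ) 0]
    · rw [lowerOn_of_notMem a _ hw, lowerOn_of_notMem a _ hw]
      linarith) v
  exact ⟨h.1, by linarith [h.2]⟩

theorem IsNonexpansive.mem_approxAt_of_le_maxDecreaseAt (hf : IsNonexpansive f) (h : f a v ≠ 0)
    (hθ : θ ≤ maxDecreaseAt f a S v) : v ∈ approxAt f a θ S :=
  hf.mem_approxAt_of_le (mem_approxAt_maxDecreaseAt h) hθ

variable [Finite V]

/-- If `a` is not below the pre-fixpoint `m` of `f`, then a small decrease on the set where `a - m`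
is maximal is propagated to this set by `f`. -/
theorem IsNonexpansive.exists_decrease (hf : IsNonexpansive f) (hm : f m ≤ m) (h : ¬ a ≤ m) :
    ∃ S : Set V, S.Nonempty ∧ ∃ θ : unitInterval, 0 < θ ∧ ∀ v ∈ S, f a v ≤ a v ∧ θ ≤ a v ∧
      (θ : ℝ) + f (lowerOn a θ S) v ≤ a v := by
  classical
  obtain ⟨w, hw⟩ : ∃ w, m w < a w := by
    simpa [Pi.le_def] using h
  have hw : (m w : ℝ) < a w := hw
  have : Nonempty V := ⟨w⟩
  obtain ⟨u, hu⟩ := Finite.exists_max fun v => (a v : ℝ) - m v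
  set d : ℝ := (a u : ℝ) - m u with hd
  have hd0 : 0 < d := by linarith [hu w]
  set S : Set V := {v | (a v : ℝ) - m v = d} with hS
  have huS : u ∈ S := rfl
  -- The decrease `e` is the gap between the largest excess `d` and the next one; the value `d` on
  -- `S` caps it at `d`, which also covers the case that `S` is everything.
  obtain ⟨t, ht⟩ := Finite.exists_min fun v => if v ∈ S then d else d - ((a v : ℝ) - m v)
  set e : ℝ := if t ∈ S then d else d - ((a t : ℝ) - m t) with he
  have hed : e ≤ d := by simpa [huS] using ht u
  have he0 : 0 < e := by
    by_cases htS : t ∈ S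
    · rw [he, if_pos htS]; exact hd0
    · rw [he, if_neg htS]
      have h1 : (a t : ℝ) - m t ≠ d := htS
      linarith [lt_of_le_of_ne (hu t) h1]
  have hd1 : d ≤ 1 := by linarith [(a u).2.2, (m u).2.1]
  refine ⟨S, ⟨u, huS⟩, ⟨e, he0.le, hed.trans hd1⟩, he0, fun v hv => ?_⟩
  have hv' : (a v : ℝ) - m v = d := hv
  have hmv : (f m v : ℝ) ≤ m v := hm v
  have hea : e ≤ a v := by linarith [(m v).2.1]
  refine ⟨?_, hea, ?_⟩
  · have := hf a m d hd0.le (fun x => by linarith [hu x]) v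
    refine Subtype.coe_le_coe.1 ?_
    linarith
  -- After the decrease the excess over `m` is at most `d - e` everywhere, on `S` by the subtraction
  -- and off `S` by the gap.
  · have := hf (lowerOn a ⟨e, he0.le, hed.trans hd1⟩ S) m (d - e) (sub_nonneg.2 hed) (fun x => by
      by_cases hx : x ∈ S
      · have hx' : (a x : ℝ) - m x = d := hx
        rw [lowerOn_of_mem a _ hx]
        refine max_le ?_ ?_
        · change (a x : ℝ) - e ≤ _
          linarith
        · linarith [(m x).2.1]
      · rw [lowerOn_of_notMem a _ hx]
        have := ht x
        rw [if_neg hx] at this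
        linarith) v
    change e + (_ : ℝ) ≤ _
    linarith

theorem leastPos_ne_zero (a : V → unitInterval) : leastPos a ≠ 0 := by
  -- Adjoining `⊤` makes the set non-empty, so the infimum of this finite set is one of its
  -- elements.
  have h : leastPos a = sInf (insert ⊤ (a '' posSet a)) := by
    rw [sInf_insert, top_inf_eq, sInf_image, leastPos]
  have hmem := (insert_nonempty ⊤ (a '' posSet a)).csInf_mem ((toFinite _).insert _)
  rw [← h] at hmem
  rcases hmem with hmem | ⟨v, hv, hmem⟩
  · rw [hmem]; exact one_ne_zero
  · rw [← hmem]; exact hv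

theorem approxDecrease_pos (f : (V → unitInterval) →o (V → unitInterval)) (a : V → unitInterval) :
    0 < approxDecrease f a := by
  refine unitInterval.pos_iff_ne_zero.2 ?_
  have hfin : ({θ : unitInterval | ∃ S : Set V, S ⊆ posSet a ∧ ∃ v ∈ posSet (f a),
      maxDecreaseAt f a S v = θ ∧ θ ≠ 0} ∪ {leastPos a}).Finite := by
    refine Finite.union ?_ (finite_singleton _)
    refine (finite_range fun p : Set V × V => maxDecreaseAt f a p.1 p.2).subset ?_
    rintro θ ⟨S, -, v, -, rfl, -⟩
    exact ⟨(S, v), rfl⟩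
  have hmem := Set.Nonempty.csInf_mem ⟨leastPos a, Or.inr rfl⟩ hfin
  rcases hmem with ⟨S, -, v, -, -, h⟩ | h
  · exact h
  · rw [approxDecrease, mem_singleton_iff.1 h]
    exact leastPos_ne_zero a

/-- Otherwise `exists_decrease` yields a non-empty `S` on which every `maxDecreaseAt` is positive.
These numbers compete in the infimum defining `approxDecrease`, so `S` is a post-fixpoint of `approx
f a`. -/
theorem IsNonexpansive.le_of_gfp_approx_eq_empty (hf : IsNonexpansive f) (ha : f a = a)
    (hm : f m ≤ m) (h : OrderHom.gfp (approx f a) = ∅) : a ≤ m := by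
  by_contra ham
  obtain ⟨S, hS, θ, hθ, hdec⟩ := hf.exists_decrease hm ham
  have hpos : ∀ v ∈ S, a v ≠ 0 := fun v hv => (hθ.trans_le (hdec v hv).2.1).ne'
  have hsub : S ≤ approx f a S := by
    intro v hv
    have hfa : f a v ≠ 0 := by rw [ha]; exact hpos v hv
    refine hf.mem_approxAt_of_le_maxDecreaseAt hfa (sInf_le (Or.inl ?_))
    refine ⟨S, fun w hw => hpos w hw, v, hfa, rfl, ?_⟩
    refine (hθ.trans_le (le_maxDecreaseAt (mem_approxAt_iff.2 ⟨hfa, ?_⟩))).ne'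
    rw [ha]
    exact (hdec v hv).2.2
  have := OrderHom.le_gfp _ hsub
  rw [h] at this
  exact hS.ne_empty (subset_empty_iff.1 this)

/-- Lowering a fixpoint along a non-empty post-fixpoint of its dual approximation yields a strictly
smaller pre-fixpoint. -/
theorem IsNonexpansive.lowerOn_maxDecreaseOn (hf : IsNonexpansive f) (ha : f a = a)
    (hS : S ⊆ approx f a S) (hne : S ≠ ∅) :
    f (lowerOn a (maxDecreaseOn f a S) S) ≤ lowerOn a (maxDecreaseOn f a S) S ∧
      lowerOn a (maxDecreaseOn f a S) S < a := by
  set θ := maxDecreaseOn f a S with hθ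
  have hθ0 : 0 < θ := (approxDecrease_pos f a).trans_le
    (le_iInf₂ fun v hv => le_maxDecreaseAt (hS hv))
  constructor
  · intro v
    by_cases hv : v ∈ S
    · have hmem := hf.mem_approxAt_of_le_maxDecreaseAt (θ := θ) (hS hv).1 (iInf₂_le v hv)
      have h := (mem_approxAt_iff.1 hmem).2
      rw [ha] at h
      refine Subtype.coe_le_coe.1 ?_
      rw [lowerOn_of_mem a θ hv]
      exact le_max_of_le_left (by linarith)
    · refine (f.monotone (lowerOn_le a θ S) v).trans ?_
      rw [ha, lowerOn_of_notMem a θ hv]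
  · obtain ⟨v, hv⟩ := nonempty_iff_ne_empty.2 hne
    refine lt_of_le_of_ne (lowerOn_le a θ S) fun h => ?_
    have h1 : (lowerOn a θ S v : ℝ) = a v := by rw [h]
    have h2 : f a v ≠ 0 := (hS hv).1
    rw [ha] at h2
    have h3 : (0 : ℝ) < a v := unitInterval.pos_iff_ne_zero.2 h2
    have h4 : (0 : ℝ) < θ := hθ0
    rw [lowerOn_of_mem a θ hv] at h1
    exact absurd h1 (max_lt (by linarith) h3).ne

end Approximation

/-! ## Value functions of simple stochastic games -/

theorem Finset.coe_inf_le_coe_inf_add {V : Type*} (s : Finset V) {a b : V → unitInterval} {c : ℝ}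
    (hc : 0 ≤ c) (h : ∀ v, (a v : ℝ) ≤ b v + c) : ((s.inf a : unitInterval) : ℝ) ≤ (s.inf b : unitInterval) + c := by
  rcases s.eq_empty_or_nonempty with rfl | hs
  -- Both infima over `∅` equal `1`.
  · simpa using hc
  · obtain ⟨w, hw, hb⟩ := s.exists_mem_eq_inf hs b
    have : ((s.inf a : unitInterval) : ℝ) ≤ a w := Finset.inf_le (f := a) hw
    rw [hb]
    exact this.trans (h w)

theorem Finset.coe_sup_le_coe_sup_add {V : Type*} (s : Finset V) {a b : V → unitInterval} {c : ℝ}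
    (hc : 0 ≤ c) (h : ∀ v, (a v : ℝ) ≤ b v + c) : ((s.sup a : unitInterval) : ℝ) ≤ (s.sup b : unitInterval) + c := by
  rcases s.eq_empty_or_nonempty with rfl | hs
  · simpa using hc
  · obtain ⟨w, hw, ha⟩ := s.exists_mem_eq_sup hs a
    have : (b w : ℝ) ≤ (s.sup b : unitInterval) := Finset.le_sup (f := b) hw
    rw [ha]
    linarith [h w]

theorem average_le_average_add {V : Type*} [Fintype V] (p : stdSimplex ℝ V)
    {a b : V → unitInterval} {c : ℝ} (h : ∀ v, (a v : ℝ) ≤ b v + c) :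
    (average p a : ℝ) ≤ average p b + c := by
  have h1 : ∑ v, p.1 v * (a v : ℝ) ≤ ∑ v, p.1 v * ((b v : ℝ) + c) :=
    Finset.sum_le_sum fun v _ => mul_le_mul_of_nonneg_left (h v) (p.2.1 v)
  have h2 : ∑ v, p.1 v = 1 := p.2.2
  simp only [mul_add, Finset.sum_add_distrib, ← Finset.sum_mul, h2, one_mul] at h1
  exact h1

namespace SimpleStochasticGame

variable {V : Type*} [Fintype V] (G : SimpleStochasticGame V)

section OneStep

variable {G} {mn : G.MinNode → unitInterval} {mx : G.MaxNode → unitInterval} {a : V → unitInterval}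

theorem oneStep_min (v : G.MinNode) : G.oneStep mn mx a v = mn v := by
  obtain ⟨v, hv⟩ := v
  unfold oneStep
  split <;> rename_i h <;> first | rfl | exact absurd (hv.symm.trans h) nofun

theorem oneStep_max (v : G.MaxNode) : G.oneStep mn mx a v = mx v := by
  obtain ⟨v, hv⟩ := v
  unfold oneStep
  split <;> rename_i h <;> first | rfl | exact absurd (hv.symm.trans h) nofun

theorem oneStep_congr {mn' : G.MinNode → unitInterval} {mx' : G.MaxNode → unitInterval} {v : V}
    (hmin : ∀ h, mn ⟨v, h⟩ = mn' ⟨v, h⟩) (hmax : ∀ h, mx ⟨v, h⟩ = mx' ⟨v, h⟩) :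
    G.oneStep mn mx a v = G.oneStep mn' mx' a v := by
  unfold oneStep
  split
  · exact hmin _
  · exact hmax _
  · rfl
  · rfl

theorem oneStep_le_oneStep_add {mn' : G.MinNode → unitInterval} {mx' : G.MaxNode → unitInterval}
    {a' : V → unitInterval} {c : ℝ} (hc : 0 ≤ c) (hmin : ∀ v, (mn v : ℝ) ≤ mn' v + c)
    (hmax : ∀ v, (mx v : ℝ) ≤ mx' v + c) (ha : ∀ v, (a v : ℝ) ≤ a' v + c) (v : V) :
    (G.oneStep mn mx a v : ℝ) ≤ G.oneStep mn' mx' a' v + c := by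
  unfold oneStep
  split
  · exact hmin _
  · exact hmax _
  · exact average_le_average_add _ ha
  · linarith

end OneStep

theorem value_apply (a : V → unitInterval) : G.value a =
    G.oneStep (fun v => (G.succMin v).inf a) (fun v => (G.succMax v).sup a) a := rfl

theorem valueMin_apply (τ : G.MinStrategy) (a : V → unitInterval) : G.valueMin τ a =
    G.oneStep (fun v => a (τ v)) (fun v => (G.succMax v).sup a) a := rfl

theorem valueMax_apply (σ : G.MaxStrategy) (a : V → unitInterval) : G.valueMax σ a =
    G.oneStep (fun v => (G.succMin v).inf a) (fun v => a (σ v)) a := rfl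

theorem isNonexpansive_value : IsNonexpansive G.value := fun _ _ _ hc h =>
  oneStep_le_oneStep_add hc (fun _ => Finset.coe_inf_le_coe_inf_add _ hc h)
    (fun _ => Finset.coe_sup_le_coe_sup_add _ hc h) h

theorem isNonexpansive_valueMax (σ : G.MaxStrategy) : IsNonexpansive (G.valueMax σ) :=
  fun _ _ _ hc h => oneStep_le_oneStep_add hc (fun _ => Finset.coe_inf_le_coe_inf_add _ hc h)
    (fun _ => h _) h

theorem value_le_valueMin (τ : G.MinStrategy) (a : V → unitInterval) :
    G.value a ≤ G.valueMin τ a :=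
  G.oneStep_mono (fun v => Finset.inf_le (τ v).2) le_rfl le_rfl

theorem valueMax_le_value (σ : G.MaxStrategy) (a : V → unitInterval) :
    G.valueMax σ a ≤ G.value a :=
  G.oneStep_mono le_rfl (fun v => Finset.le_sup (f := a) (σ v).2) le_rfl

/-! ## Switching -/

theorem exists_isSwitchMin (τ : G.MinStrategy) (a : V → unitInterval) :
    ∃ τ', G.IsSwitchMin τ a τ' := by
  have h : ∀ v : G.MinNode, ∃ w : {w : V // w ∈ G.succMin v},
      ((G.succMin v).inf a < a (τ v) → a w = (G.succMin v).inf a) ∧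
      (¬ (G.succMin v).inf a < a (τ v) → w = τ v) := by
    intro v
    by_cases hv : (G.succMin v).inf a < a (τ v)
    · obtain ⟨w, hw, h⟩ := (G.succMin v).exists_mem_eq_inf ⟨_, (τ v).2⟩ a
      exact ⟨⟨w, hw⟩, fun _ => h.symm, fun h' => absurd hv h'⟩
    · exact ⟨τ v, fun h' => absurd h' hv, fun _ => rfl⟩
  choose τ' hτ' using h
  exact ⟨τ', hτ'⟩

theorem exists_isSwitchMax (σ : G.MaxStrategy) (a : V → unitInterval) :
    ∃ σ', G.IsSwitchMax σ a σ' := by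
  have h : ∀ v : G.MaxNode, ∃ w : {w : V // w ∈ G.succMax v},
      (a (σ v) < (G.succMax v).sup a → a w = (G.succMax v).sup a) ∧
      (¬ a (σ v) < (G.succMax v).sup a → w = σ v) := by
    intro v
    by_cases hv : a (σ v) < (G.succMax v).sup a
    · obtain ⟨w, hw, h⟩ := (G.succMax v).exists_mem_eq_sup ⟨_, (σ v).2⟩ a
      exact ⟨⟨w, hw⟩, fun _ => h.symm, fun h' => absurd hv h'⟩
    · exact ⟨σ v, fun h' => absurd h' hv, fun _ => rfl⟩
  choose σ' hσ' using h
  exact ⟨σ', hσ'⟩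

variable {G}

/-- A node that is not switched already attains the minimum. -/
theorem IsSwitchMin.valueMin_eq {τ τ' : G.MinStrategy} {a : V → unitInterval}
    (h : G.IsSwitchMin τ a τ') : G.valueMin τ' a = G.value a := by
  funext v
  rw [valueMin_apply, value_apply]
  refine oneStep_congr (fun hv => ?_) fun _ => rfl
  by_cases hlt : (G.succMin ⟨v, hv⟩).inf a < a (τ ⟨v, hv⟩)
  · exact (h _).1 hlt
  · rw [(h _).2 hlt]
    exact le_antisymm (not_lt.1 hlt) (Finset.inf_le (τ _).2)

theorem IsSwitchMax.valueMax_eq {σ σ' : G.MaxStrategy} {a : V → unitInterval}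
    (h : G.IsSwitchMax σ a σ') : G.valueMax σ' a = G.value a := by
  funext v
  rw [valueMax_apply, value_apply]
  refine oneStep_congr (fun _ => rfl) fun hv => ?_
  by_cases hlt : a (σ ⟨v, hv⟩) < (G.succMax ⟨v, hv⟩).sup a
  · exact (h _).1 hlt
  · rw [(h _).2 hlt]
    exact le_antisymm (Finset.le_sup (f := a) (σ _).2) (not_lt.1 hlt)

theorem IsSwitchMin.eq_of_value_eq {τ τ' : G.MinStrategy} {a : V → unitInterval}
    (h : G.IsSwitchMin τ a τ') (ha : G.valueMin τ a = G.value a) : τ' = τ := by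
  funext v
  refine (h v).2 (not_lt.2 (le_of_eq ?_))
  have h1 : G.valueMin τ a v = G.value a v := by rw [ha]
  have h2 : G.valueMin τ a v = a (τ v) := by rw [valueMin_apply, oneStep_min]
  have h3 : G.value a v = (G.succMin v).inf a := by rw [value_apply, oneStep_min]
  rw [← h2, h1, h3]

theorem IsSwitchMax.apply_eq {σ σ' : G.MaxStrategy} {a : V → unitInterval}
    (h : G.IsSwitchMax σ a σ') {v : G.MaxNode} (ha : G.value a v ≤ G.valueMax σ a v) :
    σ' v = σ v := by
  refine (h v).2 (not_lt.2 ?_)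
  have h2 : G.valueMax σ a v = a (σ v) := by rw [valueMax_apply, oneStep_max]
  have h3 : G.value a v = (G.succMax v).sup a := by rw [value_apply, oneStep_max]
  rwa [h2, h3] at ha

/-! ### Progress of the least fixpoints under switching. -/

theorem IsSwitchMin.lfp_lt {τ τ' : G.MinStrategy}
    (h : G.IsSwitchMin τ (OrderHom.lfp (G.valueMin τ)) τ') (hne : τ' ≠ τ) :
    OrderHom.lfp (G.valueMin τ') < OrderHom.lfp (G.valueMin τ) := by
  have hfix : G.valueMin τ (OrderHom.lfp (G.valueMin τ)) = OrderHom.lfp (G.valueMin τ) :=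
    OrderHom.map_lfp _
  have hle : G.valueMin τ' (OrderHom.lfp (G.valueMin τ)) ≤ OrderHom.lfp (G.valueMin τ) := by
    rw [h.valueMin_eq]
    exact (G.value_le_valueMin τ _).trans_eq hfix
  refine lt_of_le_of_ne (OrderHom.lfp_le _ hle) fun heq => hne (h.eq_of_value_eq ?_)
  rw [← h.valueMin_eq, hfix]
  conv_rhs => rw [← heq]
  rw [OrderHom.map_lfp, heq]

theorem IsSwitchMin.lfp_lt_of_lt {τ τ' : G.MinStrategy} {a b : V → unitInterval}
    (h : G.IsSwitchMin τ b τ') (hb : G.value b ≤ b) (hba : b < a) :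
    OrderHom.lfp (G.valueMin τ') < a :=
  (OrderHom.lfp_le _ (h.valueMin_eq.trans_le hb)).trans_lt hba

/-- Were this false, the decrease given by `exists_decrease` for `valueMax σ'` would also be
propagated by `valueMax σ`: no node of `S` is switched, because switching keeps `σ` where it is
already optimal. Then the least fixpoint for `σ` could be lowered to a smaller pre-fixpoint. -/
theorem IsSwitchMax.lfp_le_lfp {σ σ' : G.MaxStrategy}
    (h : G.IsSwitchMax σ (OrderHom.lfp (G.valueMax σ)) σ') :
    OrderHom.lfp (G.valueMax σ) ≤ OrderHom.lfp (G.valueMax σ') := by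
  by_contra hle
  obtain ⟨S, ⟨u, hu⟩, θ, hθ, hdec⟩ := (G.isNonexpansive_valueMax σ').exists_decrease
    (OrderHom.map_lfp _).le hle
  set a := OrderHom.lfp (G.valueMax σ) with ha
  have hfix : G.valueMax σ a = a := OrderHom.map_lfp _
  have hpre : G.valueMax σ (lowerOn a θ S) ≤ lowerOn a θ S := by
    intro v
    by_cases hv : v ∈ S
    · have heq : G.valueMax σ (lowerOn a θ S) v = G.valueMax σ' (lowerOn a θ S) v := by
        rw [valueMax_apply, valueMax_apply]
        refine oneStep_congr (fun _ => rfl) fun hk => ?_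
        have : σ' ⟨v, hk⟩ = σ ⟨v, hk⟩ := by
          refine h.apply_eq ?_
          rw [← h.valueMax_eq, hfix]
          -- A switched node would strictly gain, but `valueMax σ' a ≤ a` on `S`.
          exact (hdec v hv).1
        change lowerOn a θ S (σ ⟨v, hk⟩) = lowerOn a θ S (σ' ⟨v, hk⟩)
        rw [this]
      rw [heq]
      refine Subtype.coe_le_coe.1 ?_
      rw [lowerOn_of_mem a θ hv]
      exact le_max_of_le_left (by linarith [(hdec v hv).2.2])
    · refine ((G.valueMax σ).monotone (lowerOn_le a θ S) v).trans ?_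
      rw [hfix, lowerOn_of_notMem a θ hv]
  have h1 : (a u : ℝ) ≤ lowerOn a θ S u := OrderHom.lfp_le _ hpre u
  have h2 : (0 : ℝ) < θ := hθ
  have h3 : (θ : ℝ) ≤ a u := (hdec u hu).2.1
  rw [lowerOn_of_mem a θ hu] at h1
  exact absurd h1 (not_le.2 (max_lt (by linarith) (by linarith)))

theorem IsSwitchMax.lfp_lt {σ σ' : G.MaxStrategy}
    (h : G.IsSwitchMax σ (OrderHom.lfp (G.valueMax σ)) σ') (hne : σ' ≠ σ) :
    OrderHom.lfp (G.valueMax σ) < OrderHom.lfp (G.valueMax σ') := by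
  refine lt_of_le_of_ne h.lfp_le_lfp fun heq => hne (funext fun v => h.apply_eq ?_)
  rw [← h.valueMax_eq, OrderHom.map_lfp (G.valueMax σ), heq, OrderHom.map_lfp]

theorem IsSwitchMin.isFixed {τ : G.MinStrategy}
    (h : G.IsSwitchMin τ (OrderHom.lfp (G.valueMin τ)) τ) :
    G.value (OrderHom.lfp (G.valueMin τ)) = OrderHom.lfp (G.valueMin τ) := by
  rw [← h.valueMin_eq, OrderHom.map_lfp]

/-- Leastness is automatic here as `valueMax σ ≤ value`. For Min the inequality points the other
way, so stability gives only some fixpoint and the check by `approx` is needed. -/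
theorem IsSwitchMax.lfp_eq {σ : G.MaxStrategy}
    (h : G.IsSwitchMax σ (OrderHom.lfp (G.valueMax σ)) σ) :
    OrderHom.lfp (G.valueMax σ) = OrderHom.lfp G.value := by
  refine le_antisymm (OrderHom.lfp_le _ ?_) (OrderHom.lfp_le _ ?_)
  · exact (G.valueMax_le_value σ _).trans_eq (OrderHom.map_lfp _)
  · rw [← h.valueMax_eq, OrderHom.map_lfp]

end SimpleStochasticGame

/-! ## Termination -/

theorem AlwaysEndsIn.of_invariant {C : Type*} {step : C → C → Prop} {start final : C}
    (inv : C → Prop) (rank : C → ℕ) (hstart : inv start)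
    (hstep : ∀ c c', inv c → step c c' → inv c' ∧ rank c' < rank c)
    (hfinal : ∀ c, inv c → (∀ c', ¬ step c c') → c = final) : AlwaysEndsIn step start final := by
  constructor
  · rintro ⟨run, h0, hrun⟩
    have hinv : ∀ n, inv (run n) := fun n => by
      induction n with
      | zero => rwa [h0]
      | succ n ih => exact (hstep _ _ ih (hrun n)).1
    exact not_strictAnti_of_wellFoundedLT (fun n => rank (run n))
      (strictAnti_nat_of_succ_lt fun n => (hstep _ _ (hinv n) (hrun n)).2)
  · intro c hc
    refine hfinal c ?_
    induction hc with
    | refl => exact hstart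
    | tail _ h ih => exact (hstep _ _ ih h).1

theorem ncard_lt_ncard_of_lt {ι α : Type*} [Finite ι] [Preorder α] (g : ι → α) {i : ι} {a b : α}
    (hb : g i < b) (hab : a ≤ g i) : {j | g j < a}.ncard < {j | g j < b}.ncard :=
  ncard_lt_ncard (ssubset_iff_of_subset (fun _ hj => hj.trans (hab.trans_lt hb)) |>.2
    ⟨i, hb, fun h => lt_irrefl _ (h.trans_le hab)⟩)

theorem ncard_gt_lt_ncard_of_lt {ι α : Type*} [Finite ι] [Preorder α] (g : ι → α) {i j : ι}
    (h : g i < g j) : {k | g j < g k}.ncard < {k | g i < g k}.ncard :=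
  ncard_lt_ncard (ssubset_iff_of_subset (fun _ hk => h.trans hk) |>.2
    ⟨j, h, lt_irrefl _⟩)

/-! ### Invariants, ranks and absence of stuck configurations. -/

namespace SimpleStochasticGame

variable {V : Type*} [Fintype V] (G : SimpleStochasticGame V)

/-- The invariant of strategy iteration from above. -/
def AboveInv : G.AboveConfig → Prop
  | .evaluate _ => True
  | .improve τ a => a = OrderHom.lfp (G.valueMin τ)
  | .compare τ a τ' => a = OrderHom.lfp (G.valueMin τ) ∧ G.IsSwitchMin τ a τ'
  | .check τ a => a = OrderHom.lfp (G.valueMin τ) ∧ G.value a = a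
  | .escape τ a S => a = OrderHom.lfp (G.valueMin τ) ∧ G.value a = a ∧
      S = OrderHom.gfp (approx G.value a)
  | .returned a => a = OrderHom.lfp G.value

/-- The number of Min-strategies that are better than `τ`. -/
noncomputable def betterMin (τ : G.MinStrategy) : ℕ :=
  {τ' : G.MinStrategy | OrderHom.lfp (G.valueMin τ') < OrderHom.lfp (G.valueMin τ)}.ncard

/-- A bound on the number of steps that remain in strategy iteration from above. -/
noncomputable def aboveRank : G.AboveConfig → ℕ
  | .evaluate τ => 6 * G.betterMin τ + 5
  | .improve τ _ => 6 * G.betterMin τ + 4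
  | .compare τ _ _ => 6 * G.betterMin τ + 3
  | .check τ _ => 6 * G.betterMin τ + 2
  | .escape τ _ _ => 6 * G.betterMin τ + 1
  | .returned _ => 0

/-- The invariant of strategy iteration from below. -/
def BelowInv : G.BelowConfig → Prop
  | .evaluate _ => True
  | .improve σ a => a = OrderHom.lfp (G.valueMax σ)
  | .compare σ a σ' => a = OrderHom.lfp (G.valueMax σ) ∧ G.IsSwitchMax σ a σ'
  | .returned a => a = OrderHom.lfp G.value

/-- The number of Max-strategies that are better than `σ`. -/
noncomputable def betterMax (σ : G.MaxStrategy) : ℕ :=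
  {σ' : G.MaxStrategy | OrderHom.lfp (G.valueMax σ) < OrderHom.lfp (G.valueMax σ')}.ncard

/-- A bound on the number of steps that remain in strategy iteration from below. -/
noncomputable def belowRank : G.BelowConfig → ℕ
  | .evaluate σ => 4 * G.betterMax σ + 3
  | .improve σ _ => 4 * G.betterMax σ + 2
  | .compare σ _ _ => 4 * G.betterMax σ + 1
  | .returned _ => 0

variable {G}

theorem betterMin_lt {τ τ' : G.MinStrategy}
    (h : OrderHom.lfp (G.valueMin τ') < OrderHom.lfp (G.valueMin τ)) :
    G.betterMin τ' < G.betterMin τ :=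
  ncard_lt_ncard_of_lt (fun τ => OrderHom.lfp (G.valueMin τ)) h le_rfl

theorem betterMax_lt {σ σ' : G.MaxStrategy}
    (h : OrderHom.lfp (G.valueMax σ) < OrderHom.lfp (G.valueMax σ')) :
    G.betterMax σ' < G.betterMax σ :=
  ncard_gt_lt_ncard_of_lt (fun σ => OrderHom.lfp (G.valueMax σ)) h

/-- Within a round the offset in `aboveRank` drops; on returning to `evaluate`, `betterMin` drops by
at least one, and the factor `6` outweighs the restored offset. -/
theorem AboveStep.inv_and_rank_lt {c c' : G.AboveConfig} (hc : G.AboveInv c)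
    (h : G.AboveStep c c') : G.AboveInv c' ∧ G.aboveRank c' < G.aboveRank c := by
  cases h with
  | evaluate τ => exact ⟨rfl, by simp only [aboveRank]; omega⟩
  | improve τ a τ' h => exact ⟨⟨hc, h⟩, by simp only [aboveRank]; omega⟩
  | changed τ a τ' hne =>
    obtain ⟨rfl, h⟩ := hc
    have := betterMin_lt (h.lfp_lt hne)
    exact ⟨trivial, by simp only [aboveRank]; omega⟩
  | unchanged τ a =>
    obtain ⟨rfl, h⟩ := hc
    exact ⟨⟨rfl, h.isFixed⟩, by simp only [aboveRank]; omega⟩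
  | check τ a => exact ⟨⟨hc.1, hc.2, rfl⟩, by simp only [aboveRank]; omega⟩
  | finish τ a =>
    obtain ⟨-, hfix, hS⟩ := hc
    refine ⟨le_antisymm ?_ (OrderHom.lfp_le _ hfix.le), by simp only [aboveRank]; omega⟩
    exact G.isNonexpansive_value.le_of_gfp_approx_eq_empty hfix (OrderHom.map_lfp _).le hS.symm
  | escape τ a S hne τ' h =>
    obtain ⟨ha, hfix, hS⟩ := hc
    -- Only the post-fixpoint half of the greatest fixpoint equation is needed to escape.
    have hpost : S ⊆ approx G.value a S := by
      rw [hS]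
      exact (OrderHom.map_gfp (approx G.value a)).ge
    obtain ⟨h1, h2⟩ := G.isNonexpansive_value.lowerOn_maxDecreaseOn hfix hpost hne
    have := betterMin_lt ((h.lfp_lt_of_lt h1 h2).trans_eq ha)
    exact ⟨trivial, by simp only [aboveRank]; omega⟩

theorem AboveConfig.eq_returned {c : G.AboveConfig} (hc : G.AboveInv c)
    (h : ∀ c', ¬ G.AboveStep c c') : c = .returned (OrderHom.lfp G.value) := by
  cases c with
  | evaluate τ => exact absurd (.evaluate τ) (h _)
  | improve τ a =>
    obtain ⟨τ', hτ'⟩ := G.exists_isSwitchMin τ a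
    exact absurd (.improve τ a τ' hτ') (h _)
  | compare τ a τ' =>
    by_cases heq : τ' = τ
    · subst heq
      exact absurd (.unchanged τ' a) (h _)
    · exact absurd (.changed τ a τ' heq) (h _)
  | check τ a => exact absurd (.check τ a) (h _)
  | escape τ a S =>
    by_cases hS : S = ∅
    · subst hS
      exact absurd (.finish τ a) (h _)
    · obtain ⟨τ', hτ'⟩ := G.exists_isSwitchMin τ (lowerOn a (maxDecreaseOn G.value a S) S)
      exact absurd (.escape τ a S hS τ' hτ') (h _)
  | returned a => exact congrArg _ hc

theorem BelowStep.inv_and_rank_lt {c c' : G.BelowConfig} (hc : G.BelowInv c)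
    (h : G.BelowStep c c') : G.BelowInv c' ∧ G.belowRank c' < G.belowRank c := by
  cases h with
  | evaluate σ => exact ⟨rfl, by simp only [belowRank]; omega⟩
  | improve σ a σ' h => exact ⟨⟨hc, h⟩, by simp only [belowRank]; omega⟩
  | changed σ a σ' hne =>
    obtain ⟨rfl, h⟩ := hc
    have := betterMax_lt (h.lfp_lt hne)
    exact ⟨trivial, by simp only [belowRank]; omega⟩
  | finish σ a =>
    obtain ⟨rfl, h⟩ := hc
    exact ⟨h.lfp_eq, by simp only [belowRank]; omega⟩

theorem BelowConfig.eq_returned {c : G.BelowConfig} (hc : G.BelowInv c)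
    (h : ∀ c', ¬ G.BelowStep c c') : c = .returned (OrderHom.lfp G.value) := by
  cases c with
  | evaluate σ => exact absurd (.evaluate σ) (h _)
  | improve σ a =>
    obtain ⟨σ', hσ'⟩ := G.exists_isSwitchMax σ a
    exact absurd (.improve σ a σ' hσ') (h _)
  | compare σ a σ' =>
    by_cases heq : σ' = σ
    · subst heq
      exact absurd (.finish σ' a) (h _)
    · exact absurd (.changed σ a σ' heq) (h _)
  | returned a => exact congrArg _ hc

end SimpleStochasticGame

open SimpleStochasticGame in
theorem mainTheorem7 {V : Type*} [Fintype V] (G : SimpleStochasticGame V) :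
    (∀ τ₀ : G.MinStrategy,
      AlwaysEndsIn G.AboveStep (.evaluate τ₀) (.returned (OrderHom.lfp G.value))) ∧
    (∀ σ₀ : G.MaxStrategy,
      AlwaysEndsIn G.BelowStep (.evaluate σ₀) (.returned (OrderHom.lfp G.value))) :=
  ⟨fun _ => .of_invariant G.AboveInv G.aboveRank trivial
      (fun _ _ hc h => h.inv_and_rank_lt hc) fun _ => AboveConfig.eq_returned,
    fun _ => .of_invariant G.BelowInv G.belowRank trivial
      (fun _ _ hc h => h.inv_and_rank_lt hc) fun _ => BelowConfig.eq_returned⟩
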